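/- Let $k$ be an algebraically closed field (of any characteristic), let $A=k^{[2]}$ be a polynomial ring in two variables over $k$, let $K=\operatorname{Frac}A$, and let $F\in A\setminus k$ be a rational polynomial, i.e., for all but possibly finitely many $\lambda\in k$, $F-\lambda$ is irreducible in $A$ and the plane curve $F-\lambda=0$ is rational (its function field is $k$-isomorphic to $k(T)$). Let $d$ be the number of dicriticals of $F$ in $A$, that is, the number of valuation rings $R\neq K$ with $k(F)\subseteq R\subseteq K$, $\operatorname{Frac}R=K$ and $A\nsubseteq R$ (it is known that $d$ is finite and $d\ge 1$). Say that an element $r$ of a ring $R$ is a power if $r=r_0^m$ for some $r_0\in R$ and some integer $m>1$. A coordinate system of $A$ is a pair $(X,Y)\in A\times A$ with $A=k[X,Y]$; given one, each $M\in A$ is a polynomial $M(X,Y)$ in $X,Y$, and $M(X,0)\in k[X]$, $M(0,Y)\in k[Y]$ denote the polynomials obtained by substituting $0$ for $Y$, respectively for $X$. Let $t_1,\dots,t_{d-1}$ be distinct elements of $k$ and suppose that for each $i\in\{1,\dots,d-1\}$ we have a factorization $F-t_i=G_iH_i$ with $G_i,H_i\in A\setminus k$. Assume moreover that for each $i\in\{1,\dots,d-1\}$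 there exists a coordinate system $(X,Y)$ of $A$ (which may depend on $i$) such that one of the following conditions is satisfied: (i) $G_i(X,0)\notin k$ and $G_i(X,0)$ is not a power, $H_i(X,0)\notin k$ and $H_i(X,0)$ is not a power, and $\gcd(G_i(X,0),H_i(X,0))=1$; (ii) $G_i(X,0)\in k^*$, $H_i(X,0)\notin k$ and $H_i(X,0)$ is not a power, $G_i(0,Y)\notin k$ and $G_i(0,Y)$ is not a power, and $H_i(0,Y)\in k^*$. Then $$\{\,t\in k : F-t\text{ is reducible in }A\,\}=\{t_1,\dots,t_{d-1}\},$$ and for each $i\in\{1,\dots,d-1\}$, $F-t_i=G_iH_i$ is the prime factorization of $F-t_i$ in $A$, i.e., $G_i$ and $H_i$ are prime elements of $A$. -/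

import Mathlib

namespace PlanePoly

variable {k : Type*} [Field k]

/-- `(X, Y)` is a coordinate system of `A = k[x₀, x₁]`, that is, `A = k[X, Y]`. -/
def IsCoordinateSystem (X Y : MvPolynomial (Fin 2) k) : Prop :=
  Algebra.adjoin k {X, Y} = ⊤

/-- `g` is the expression of `G` in terms of `X, Y`, that is, `G = g(X, Y)`. When `(X, Y)` is a
coordinate system, each `G` has exactly one such expression. -/
def IsExpression (X Y G g : MvPolynomial (Fin 2) k) : Prop :=
  MvPolynomial.aeval ![X, Y] g = G

/-- The univariate polynomial `g(T, 0)`. -/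
noncomputable def restrictFst (g : MvPolynomial (Fin 2) k) : Polynomial k :=
  MvPolynomial.aeval ![Polynomial.X, 0] g

/-- The univariate polynomial `g(0, T)`. -/
noncomputable def restrictSnd (g : MvPolynomial (Fin 2) k) : Polynomial k :=
  MvPolynomial.aeval ![0, Polynomial.X] g

/-- An element `r` of a ring is a power if `r = r₀ ^ m` for some `r₀` and some `m > 1`. -/
def IsPower {R : Type*} [CommRing R] (r : R) : Prop :=
  ∃ (r₀ : R) (m : ℕ), 1 < m ∧ r = r₀ ^ m

/-- A nonzero nonunit which is a product of two nonunits. -/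
def IsReducible {R : Type*} [CommRing R] (r : R) : Prop :=
  r ≠ 0 ∧ ¬ IsUnit r ∧ ∃ a b : R, ¬ IsUnit a ∧ ¬ IsUnit b ∧ r = a * b

/-- For an irreducible `P`, the plane curve `P = 0` is rational: its function field
`Frac (A / (P))` is `k`-isomorphic to the field `k(T)` of rational functions in one variable. -/
def IsRationalCurve (P : MvPolynomial (Fin 2) k) : Prop :=
  Nonempty (FractionRing (MvPolynomial (Fin 2) k ⧸ Ideal.span {P}) ≃ₐ[k] RatFunc k)

/-- `F` is a rational polynomial: `F` is not constant and, for all but possibly finitely many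
`c ∈ k`, `F - c` is irreducible and the curve `F - c = 0` is rational. -/
def IsRationalPolynomial (F : MvPolynomial (Fin 2) k) : Prop :=
  F ∉ Set.range (MvPolynomial.C : k → MvPolynomial (Fin 2) k) ∧
    {c : k | ¬ (Irreducible (F - MvPolynomial.C c) ∧
      IsRationalCurve (F - MvPolynomial.C c))}.Finite

/-- The dicriticals of `F` in `A = k[x₀, x₁]`: the valuation rings `R` of `K = Frac A` such that
`k(F) ⊆ R`, `R ≠ K` and `A ⊈ R`. -/
def dicriticals (F : MvPolynomial (Fin 2) k) :
    Set (ValuationSubring (FractionRing (MvPolynomial (Fin 2) k))) :=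
  {R | (∀ x ∈ IntermediateField.adjoin k
          {algebraMap (MvPolynomial (Fin 2) k) (FractionRing (MvPolynomial (Fin 2) k)) F},
        x ∈ R) ∧
      R ≠ ⊤ ∧
      ∃ a : MvPolynomial (Fin 2) k, algebraMap _ (FractionRing (MvPolynomial (Fin 2) k)) a ∉ R}

/-- The number of dicriticals of `F` (a positive integer when `F` is not constant). -/
noncomputable def dic (F : MvPolynomial (Fin 2) k) : ℕ := (dicriticals F).ncard

/-- Condition (i) on two polynomials in the coordinates `(X, Y)`, with `G = g(X, Y)` and
`H = h(X, Y)`: the polynomials `g(T, 0)` and `h(T, 0)` are nonconstant, are not powers, and are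
relatively prime. -/
def ConditionOne (g h : MvPolynomial (Fin 2) k) : Prop :=
  restrictFst g ∉ Set.range (Polynomial.C : k → Polynomial k) ∧ ¬ IsPower (restrictFst g) ∧
  restrictFst h ∉ Set.range (Polynomial.C : k → Polynomial k) ∧ ¬ IsPower (restrictFst h) ∧
  IsCoprime (restrictFst g) (restrictFst h)

/-- Condition (ii): `g(T, 0)` and `h(0, T)` are nonzero constants, while `h(T, 0)` and `g(0, T)`
are nonconstant and are not powers. -/
def ConditionTwo (g h : MvPolynomial (Fin 2) k) : Prop :=
  (∃ c : k, c ≠ 0 ∧ restrictFst g = Polynomial.C c) ∧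
  restrictFst h ∉ Set.range (Polynomial.C : k → Polynomial k) ∧ ¬ IsPower (restrictFst h) ∧
  restrictSnd g ∉ Set.range (Polynomial.C : k → Polynomial k) ∧ ¬ IsPower (restrictSnd g) ∧
  (∃ c : k, c ≠ 0 ∧ restrictSnd h = Polynomial.C c)

end PlanePoly

namespace PlanePoly

/-! ### Valuations of rational rank at most one -/

section Valuations

variable {E K : Type*} [Field E] [Field K] [Algebra E K]

/-- A valuation is archimedean if the powers of each element of value less than `1` eventually
compensate the value of any given element. -/
def IsArchimedeanValuation {Γ : Type*} [LinearOrderedCommGroupWithZero Γ] (v : Valuation K Γ) :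
    Prop :=
  ∀ u w : K, v u < 1 → ∀ᶠ r : ℕ in Filter.atTop, v u ^ r * v w < 1

/-- In a polynomial relation between `u` and `w` two distinct terms must have equal value, since
otherwise the term of maximal value could not cancel. Their quotient gives the exponents. -/
theorem exists_zpow_relation {Γ : Type*} [LinearOrderedCommGroupWithZero Γ] (v : Valuation K Γ)
    [v.IsTrivialOn E] (htr : Algebra.trdeg E K ≤ 1) {u w : K} (hu : u ≠ 0) (hw : w ≠ 0) :
    ∃ m n : ℤ, (m ≠ 0 ∨ n ≠ 0) ∧ v u ^ m * v w ^ n = 1 := by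
  classical
  have hdep : ¬ AlgebraicIndependent E ![u, w] := by
    intro h
    have h2 := h.lift_cardinalMk_le_trdeg
    have h3 := h2.trans (Cardinal.lift_le.mpr htr)
    norm_num at h3
  rw [algebraicIndependent_iff] at hdep
  push Not at hdep
  obtain ⟨p, hp, hp0⟩ := hdep
  have hvu : v u ≠ 0 := v.ne_zero_iff.mpr hu
  have hvw : v w ≠ 0 := v.ne_zero_iff.mpr hw
  by_contra! hcon
  set f : (Fin 2 →₀ ℕ) → K := fun s ↦ algebraMap E K (p.coeff s) * (u ^ s 0 * w ^ s 1) with hf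
  have hsum : ∑ s ∈ p.support, f s = 0 := by
    rw [← hp, MvPolynomial.aeval_def, MvPolynomial.eval₂_eq']
    simp [hf, Fin.prod_univ_two]
  have hval : ∀ s ∈ p.support, v (f s) = v u ^ s 0 * v w ^ s 1 := by
    intro s hs
    have hc : p.coeff s ≠ 0 := MvPolynomial.mem_support_iff.mp hs
    simp [hf, Valuation.IsTrivialOn.eq_one (v := v) _ hc]
  obtain ⟨s, hs, hmax⟩ := p.support.exists_max_image (fun s ↦ v (f s))
    (MvPolynomial.support_nonempty.mpr hp0)
  have hlt : ∀ i ∈ p.support \ {s}, v (f i) < v (f s) := by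
    intro i hi
    rw [Finset.mem_sdiff, Finset.mem_singleton] at hi
    refine lt_of_le_of_ne (hmax i hi.1) fun heq ↦ ?_
    rw [hval i hi.1, hval s hs] at heq
    have hne : ((i 0 : ℤ) - s 0 ≠ 0) ∨ ((i 1 : ℤ) - s 1 ≠ 0) := by
      by_contra! hh
      apply hi.2
      ext j
      fin_cases j
      · simpa using (by omega : i 0 = s 0)
      · simpa using (by omega : i 1 = s 1)
    apply hcon _ _ hne
    rw [zpow_sub₀ hvu, zpow_sub₀ hvw]
    simp only [zpow_natCast]
    rw [div_mul_div_comm, heq, div_self]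
    exact mul_ne_zero (pow_ne_zero _ hvu) (pow_ne_zero _ hvw)
  have hs0 : v (f s) ≠ 0 := by
    rw [hval s hs]
    exact mul_ne_zero (pow_ne_zero _ hvu) (pow_ne_zero _ hvw)
  have := Valuation.map_sum_eq_of_lt v hs hlt
  rw [hsum, map_zero] at this
  exact hs0 this.symm

theorem isArchimedeanValuation_of_trdeg_le_one {Γ : Type*} [LinearOrderedCommGroupWithZero Γ]
    (v : Valuation K Γ) [v.IsTrivialOn E] (htr : Algebra.trdeg E K ≤ 1) :
    IsArchimedeanValuation v := by
  intro u w hu1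
  by_cases hu : u = 0
  · filter_upwards [Filter.eventually_ge_atTop 1] with r hr
    simp [hu, (show r ≠ 0 by omega)]
  by_cases hw : w = 0
  · simp [hw]
  have hvu : 0 < v u := zero_lt_iff.mpr (v.ne_zero_iff.mpr hu)
  have hvw : 0 < v w := zero_lt_iff.mpr (v.ne_zero_iff.mpr hw)
  have key : ∃ (m : ℤ) (n : ℕ), n ≠ 0 ∧ v u ^ m * v w ^ n = 1 := by
    obtain ⟨m, n, hmn, h⟩ := exists_zpow_relation v htr hu hw
    have hn : n ≠ 0 := by
      rintro rfl
      simp only [ne_eq, not_true_eq_false, or_false, zpow_zero, mul_one] at hmn h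
      rcases lt_or_gt_of_ne hmn with hm | hm
      · have := one_lt_zpow_of_neg₀ hvu hu1 hm
        exact this.ne' h
      · have := zpow_lt_one₀ hvu hu1 hm
        exact this.ne h
    rcases lt_or_gt_of_ne hn with hn' | hn'
    · refine ⟨-m, n.natAbs, by omega, ?_⟩
      rw [← zpow_natCast, show ((n.natAbs : ℕ) : ℤ) = -n by omega, zpow_neg, zpow_neg,
        ← mul_inv, h, inv_one]
    · refine ⟨m, n.natAbs, by omega, ?_⟩
      rw [← zpow_natCast, show ((n.natAbs : ℕ) : ℤ) = n by omega, h]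
  obtain ⟨m, n, hn, h⟩ := key
  -- The `n`-th power of `v u ^ r * v w` is `v u ^ (r * n - m)`, and `r > |m|` makes this exponent
  -- positive.
  filter_upwards [Filter.eventually_ge_atTop (m.natAbs + 1)] with r hr
  have h1 : (v u ^ r * v w) ^ n < 1 := by
    have h2 : (v u ^ r * v w) ^ n = v u ^ ((r * n : ℕ) - m : ℤ) := by
      rw [zpow_sub₀ hvu.ne', zpow_natCast, eq_div_iff (zpow_ne_zero _ hvu.ne'), mul_pow, ← pow_mul,
        mul_assoc, mul_comm (v w ^ n), h, mul_one]
    rw [h2]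
    apply zpow_lt_one₀ hvu hu1
    have : r ≤ r * n := Nat.le_mul_of_pos_right r (by omega)
    omega
  exact lt_of_not_ge fun hge ↦ absurd (one_le_pow₀ hge : 1 ≤ (v u ^ r * v w) ^ n) (not_le.mpr h1)

theorem exists_one_lt_valuation {R : ValuationSubring K} (hR : R ≠ ⊤) :
    ∃ z, 1 < R.valuation z := by
  by_contra! h
  exact hR (eq_top_iff.mpr fun z _ ↦ (R.valuation_le_one_iff z).mp (h z))

/-- A rank one valuation ring is maximal: for `z ∈ S` outside `R`, a high power of `z⁻¹` brings any
`y` into `R`, and multiplying back by powers of `z` stays in `S`. -/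
theorem not_le_of_isArchimedeanValuation {R S : ValuationSubring K}
    (hR : IsArchimedeanValuation R.valuation) (hS : S ≠ ⊤) (hne : R ≠ S) : ¬ R ≤ S := by
  intro hle
  have hnot : ¬ S ≤ R := fun h ↦ hne (le_antisymm hle h)
  obtain ⟨z, hzS, hzR⟩ := SetLike.not_le_iff_exists.mp hnot
  obtain ⟨y, hy⟩ := exists_one_lt_valuation hS
  have hz0 : z ≠ 0 := by rintro rfl; exact hzR R.zero_mem
  have hz : R.valuation z⁻¹ < 1 := by
    rw [← Valuation.one_lt_val_iff _ hz0]
    exact not_le.mp fun h ↦ hzR ((R.valuation_le_one_iff z).mp h)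
  obtain ⟨r, hr⟩ := (hR z⁻¹ y hz).exists
  rw [← map_pow, ← map_mul] at hr
  have h1 := hle ((R.valuation_le_one_iff _).mp hr.le)
  have h2 := S.mul_mem _ _ h1 (pow_mem hzS r)
  rw [mul_right_comm, ← mul_pow, inv_mul_cancel₀ hz0, one_pow, one_mul] at h2
  exact absurd ((S.valuation_le_one_iff y).mpr h2) (not_le.mpr hy)

/-! ### Weak approximation and finiteness of the set of poles -/

theorem exists_one_lt_and_lt_one {R S : ValuationSubring K}
    (hR : IsArchimedeanValuation R.valuation) (hS : IsArchimedeanValuation S.valuation)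
    (hRt : R ≠ ⊤) (hSt : S ≠ ⊤) (hne : R ≠ S) :
    ∃ z, 1 < R.valuation z ∧ S.valuation z < 1 := by
  obtain ⟨a, haR, haS⟩ := SetLike.not_le_iff_exists.mp (not_le_of_isArchimedeanValuation hR hSt hne)
  obtain ⟨b, hbS, hbR⟩ :=
    SetLike.not_le_iff_exists.mp (not_le_of_isArchimedeanValuation hS hRt hne.symm)
  rw [← ValuationSubring.valuation_le_one_iff] at haR haS hbS hbR
  rw [not_le] at haS hbR
  have ha0 : a ≠ 0 := by rintro rfl; simp at haS
  refine ⟨b / a, ?_, ?_⟩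
  · rw [map_div₀, one_lt_div₀ (zero_lt_iff.mpr ((Valuation.ne_zero_iff _).mpr ha0))]
    exact haR.trans_lt hbR
  · rw [map_div₀, div_lt_one₀ (zero_lt_iff.mpr ((Valuation.ne_zero_iff _).mpr ha0))]
    exact hbS.trans_lt haS

theorem exists_one_lt_and_forall_lt_one (S : Finset (ValuationSubring K))
    (R : ValuationSubring K) (hRS : R ∉ S)
    (hR : IsArchimedeanValuation R.valuation) (hRt : R ≠ ⊤)
    (hS : ∀ T ∈ S, IsArchimedeanValuation T.valuation ∧ T ≠ ⊤) :
    ∃ z, 1 < R.valuation z ∧ ∀ T ∈ S, T.valuation z < 1 := by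
  classical
  induction S using Finset.induction_on with
  | empty => simpa using exists_one_lt_valuation hRt
  | insert T S hTS ih =>
    rw [Finset.mem_insert, not_or] at hRS
    simp only [Finset.forall_mem_insert] at hS
    obtain ⟨z, hz1, hz⟩ := ih hRS.2 hS.2
    obtain ⟨w, hw1, hw⟩ := exists_one_lt_and_lt_one hR hS.1.1 hRt hS.1.2 hRS.1
    have hev : ∀ᶠ r : ℕ in Filter.atTop, ∀ U ∈ S, U.valuation z ^ r * U.valuation w < 1 :=
      (Filter.eventually_all_finset S).mpr fun U hU ↦ (hS.2 U hU).1 z w (hz U hU)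
    obtain ⟨r, hr, hr1⟩ := (hev.and (Filter.eventually_ge_atTop 1)).exists
    have hr0 : r ≠ 0 := by omega
    -- If `z` is large at `T`, then `z ^ r * w` may be large there as well. The factor `z ^ r / (1 +
    -- z ^ r)` replaces `z ^ r`: it is a unit where `z` is large and has the value of `z ^ r` where
    -- `z` is small.
    rcases le_or_gt (T.valuation z) 1 with hle | hgt
    · refine ⟨z ^ r * w, ?_, ?_⟩
      · rw [map_mul, map_pow]
        exact one_lt_mul_of_lt_of_le (one_lt_pow₀ hz1 hr0) hw1.le
      · simp only [Finset.forall_mem_insert, map_mul, map_pow]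
        exact ⟨(mul_le_of_le_one_left' (pow_le_one' hle r)).trans_lt hw, hr⟩
    · have hbig : ∀ U : ValuationSubring K, 1 < U.valuation z →
          U.valuation (z ^ r / (1 + z ^ r)) = 1 := by
        intro U hU
        have h1 : U.valuation (1 : K) < U.valuation (z ^ r) := by
          rw [map_one, map_pow]; exact one_lt_pow₀ hU hr0
        rw [map_div₀, Valuation.map_add_eq_of_lt_right _ h1, div_self]
        rw [map_one] at h1
        exact (zero_lt_one.trans h1).ne'
      have heq : z ^ r * w / (1 + z ^ r) = z ^ r / (1 + z ^ r) * w := by ring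
      refine ⟨z ^ r * w / (1 + z ^ r), ?_, ?_⟩
      · rw [heq, map_mul, hbig R hz1, one_mul]; exact hw1
      · simp only [Finset.forall_mem_insert]
        refine ⟨by rw [heq, map_mul, hbig T hgt, one_mul]; exact hw, fun U hU ↦ ?_⟩
        have h1 : U.valuation (z ^ r) < 1 := by
          rw [map_pow]; exact pow_lt_one₀ zero_le (hz U hU) hr0
        rw [map_div₀, Valuation.map_one_add_of_lt _ h1, div_one, map_mul, map_pow]
        exact hr U hU

theorem exists_eq_one_and_forall_lt_one (S : Finset (ValuationSubring K))
    (R : ValuationSubring K) (hRS : R ∉ S)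
    (hR : IsArchimedeanValuation R.valuation) (hRt : R ≠ ⊤)
    (hS : ∀ T ∈ S, IsArchimedeanValuation T.valuation ∧ T ≠ ⊤) :
    ∃ z, R.valuation z = 1 ∧ ∀ T ∈ S, T.valuation z < 1 := by
  obtain ⟨z, hz1, hz⟩ := exists_one_lt_and_forall_lt_one S R hRS hR hRt hS
  refine ⟨z / (1 + z), ?_, fun T hT ↦ ?_⟩
  · have h1 : R.valuation (1 : K) < R.valuation z := by rwa [map_one]
    rw [map_div₀, Valuation.map_add_eq_of_lt_right _ h1, div_self (zero_lt_one.trans hz1).ne']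
  · rw [map_div₀, Valuation.map_one_add_of_lt _ (hz T hT), div_one]
    exact hz T hT

theorem isTrivialOn_of_forall_mem {R : ValuationSubring K} (h : ∀ a : E, algebraMap E K a ∈ R) :
    R.valuation.IsTrivialOn E := by
  refine ⟨fun a ha ↦ le_antisymm ((R.valuation_le_one_iff _).mpr (h a)) ?_⟩
  have h2 := (R.valuation_le_one_iff _).mpr (h a⁻¹)
  rw [map_inv₀, map_inv₀] at h2
  exact (inv_le_one₀ (zero_lt_iff.mpr ((Valuation.ne_zero_iff _).mpr (by simpa using ha)))).mp h2

-- Both valuations restrict to the place at infinity of `E(z)`, where the value of a quotient of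
-- polynomials in `z` is decided by degrees.
open Polynomial in
theorem valuation_le_one_iff_of_mem_adjoin {R S : ValuationSubring K} [R.valuation.IsTrivialOn E]
    [S.valuation.IsTrivialOn E] {z : K} (hR : 1 < R.valuation z) (hS : 1 < S.valuation z) {a : K}
    (ha : a ∈ IntermediateField.adjoin E {z}) : R.valuation a ≤ 1 ↔ S.valuation a ≤ 1 := by
  obtain ⟨p, q, rfl⟩ := (IntermediateField.mem_adjoin_simple_iff E a).mp ha
  by_cases hp : p = 0
  · simp [hp]
  by_cases hq : q = 0
  · simp [hq]
  have key : ∀ T : ValuationSubring K, ∀ _ : T.valuation.IsTrivialOn E, 1 < T.valuation z →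
      (T.valuation (aeval z p / aeval z q) ≤ 1 ↔ p.natDegree ≤ q.natDegree) := by
    intro T hT hz
    rw [map_div₀, valuation_aeval_eq_valuation_X_pow_natDegree_of_one_lt_valuation_X _ hz hp,
      valuation_aeval_eq_valuation_X_pow_natDegree_of_one_lt_valuation_X _ hz hq,
      div_le_one₀ (pow_pos (zero_lt_one.trans hz) _), pow_le_pow_iff_right₀ hz]
  rw [key R ‹_› hR, key S ‹_› hS]

/-- Elements that are units at one pole of `z` and small at the others are independent over `E(z)`:
after division by the largest coefficient, exactly one term of a relation has value `1` at the
corresponding pole. -/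
theorem card_le_finrank_of_forall_notMem (htr : Algebra.trdeg E K ≤ 1) (z : K)
    [FiniteDimensional (IntermediateField.adjoin E {z}) K] (S : Finset (ValuationSubring K))
    (hE : ∀ R ∈ S, ∀ a : E, algebraMap E K a ∈ R) (hz : ∀ R ∈ S, z ∉ R) :
    S.card ≤ Module.finrank (IntermediateField.adjoin E {z}) K := by
  classical
  have htriv : ∀ R ∈ S, R.valuation.IsTrivialOn E := fun R hR ↦ isTrivialOn_of_forall_mem (hE R hR)
  have hgood : ∀ R ∈ S, IsArchimedeanValuation R.valuation ∧ R ≠ ⊤ := by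
    intro R hR
    have := htriv R hR
    exact ⟨isArchimedeanValuation_of_trdeg_le_one (E := E) _ htr,
      fun h ↦ hz R hR (h ▸ ValuationSubring.mem_top z)⟩
  have hz1 : ∀ R ∈ S, 1 < R.valuation z := fun R hR ↦
    not_le.mp fun h ↦ hz R hR ((R.valuation_le_one_iff z).mp h)
  have hex : ∀ R : S, ∃ e, R.1.valuation e = 1 ∧ ∀ T ∈ S.erase R.1, T.valuation e < 1 := fun R ↦
    exists_eq_one_and_forall_lt_one _ _ (Finset.notMem_erase _ _) (hgood R R.2).1 (hgood R R.2).2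
      fun T hT ↦ hgood T (Finset.mem_of_mem_erase hT)
  choose e he1 he using hex
  have hli : LinearIndependent (IntermediateField.adjoin E {z}) e := by
    rw [Fintype.linearIndependent_iff]
    intro c hc i
    by_contra hi
    -- All the valuations induce the same order on `E(z)`, so a coefficient that is maximal at `i`
    -- is also maximal at `j`.
    obtain ⟨j, -, hj⟩ := Finset.exists_max_image Finset.univ
      (fun j ↦ i.1.valuation (c j : K)) ⟨i, Finset.mem_univ _⟩
    have hcj : (c j : K) ≠ 0 := by
      intro h
      have := hj i (Finset.mem_univ _)
      rw [h, map_zero, le_zero_iff, map_eq_zero] at this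
      exact hi (Subtype.ext this)
    have hle : ∀ l, j.1.valuation ((c l : K) / c j) ≤ 1 := by
      intro l
      have := htriv i i.2
      have := htriv j j.2
      rw [← valuation_le_one_iff_of_mem_adjoin (hz1 i i.2) (hz1 j j.2)
        (div_mem (c l).2 (c j).2), map_div₀,
        div_le_one₀ (zero_lt_iff.mpr ((Valuation.ne_zero_iff _).mpr hcj))]
      exact hj l (Finset.mem_univ _)
    have hsum : ∑ l, (c l : K) / c j * e l = 0 := by
      simp only [div_mul_eq_mul_div, ← Finset.sum_div]
      rw [div_eq_zero_iff]
      left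
      simpa [IntermediateField.smul_def] using hc
    have hval := Valuation.map_sum_eq_of_lt (s := Finset.univ) (j := j) j.1.valuation
      (f := fun l ↦ (c l : K) / c j * e l) (Finset.mem_univ _) (by
        intro l hl
        have hlj : l ≠ j := by simpa using hl
        rw [map_mul, map_mul, div_self hcj, map_one, one_mul, he1]
        exact (mul_le_of_le_one_left' (hle l)).trans_lt
          (he l j (Finset.mem_erase.mpr ⟨fun h ↦ hlj (Subtype.ext h.symm), j.2⟩)))
    rw [hsum, map_zero, map_mul, div_self hcj, map_one, one_mul, he1] at hval
    exact zero_ne_one hval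
  simpa using hli.fintype_card_le_finrank

theorem finite_setOf_notMem (htr : Algebra.trdeg E K ≤ 1) (z : K)
    [FiniteDimensional (IntermediateField.adjoin E {z}) K] :
    {R : ValuationSubring K | (∀ a : E, algebraMap E K a ∈ R) ∧ z ∉ R}.Finite := by
  by_contra hinf
  obtain ⟨S, hS, hcard⟩ := Set.Infinite.exists_subset_card_eq hinf
    (Module.finrank (IntermediateField.adjoin E {z}) K + 1)
  have := card_le_finrank_of_forall_notMem htr z S (fun R hR ↦ (hS hR).1) fun R hR ↦ (hS hR).2
  omega

theorem mem_of_isAlgebraic {R : ValuationSubring K} (hE : ∀ a : E, algebraMap E K a ∈ R) {z : K}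
    (hz : IsAlgebraic E z) : z ∈ R := by
  have := isTrivialOn_of_forall_mem hE
  by_contra h
  have h1 : 1 < R.valuation z := not_le.mp fun h' ↦ h ((R.valuation_le_one_iff z).mp h')
  exact Valuation.transcendental_of_ne_one E (v := R.valuation) z
    (by rintro rfl; exact h R.zero_mem) h1.ne' hz

/-- The intersection of the valuation rings over `E` is the integral closure of `E`. -/
theorem isAlgebraic_of_forall_mem {u : K}
    (h : ∀ R : ValuationSubring K, (∀ a : E, algebraMap E K a ∈ R) → u ∈ R) : IsAlgebraic E u := by
  have h1 : u ∈ (⨅ V : {V : ValuationSubring K // Set.range (algebraMap E K) ⊆ V.toSubring},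
      V.1.toSubring) := by
    rw [Subring.mem_iInf]
    exact fun V ↦ h V.1 fun a ↦ V.2 ⟨a, rfl⟩
  rw [iInf_valuationSubring_superset] at h1
  have h2 : IsIntegral (Subring.closure (Set.range (algebraMap E K))) u := h1
  have h3 : Subring.closure (Set.range (algebraMap E K)) = (algebraMap E K).range := by
    rw [← RingHom.coe_range, Subring.closure_eq]
  rw [h3] at h2
  have h4 : IsIntegral E u := by
    obtain ⟨p, hp, hpu⟩ := h2
    have hs := (algebraMap E K).rangeRestrict_surjective
    obtain ⟨q, hq, -, hqm⟩ := Polynomial.lifts_and_natDegree_eq_and_monic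
      ((Polynomial.lifts_iff_coeff_lifts p).mpr fun n ↦ hs _ :
        p ∈ Polynomial.lifts (algebraMap E K).rangeRestrict) hp
    refine ⟨q, hqm, ?_⟩
    rw [← hq, Polynomial.eval₂_map] at hpu
    exact hpu
  exact h4.isAlgebraic

/-- Among more nonzero elements than valuations of rational rank at most one there is a
multiplicative relation all of whose values are trivial. -/
theorem exists_prod_zpow_valuation_eq_one (htr : Algebra.trdeg E K ≤ 1)
    (S : Finset (ValuationSubring K)) (hE : ∀ R ∈ S, ∀ a : E, algebraMap E K a ∈ R) :
    ∀ {ι : Type*} (T : Finset ι) (u : ι → K), (∀ i ∈ T, u i ≠ 0) → S.card < T.card →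
      ∃ e : ι → ℤ, (∃ i ∈ T, e i ≠ 0) ∧ ∀ R ∈ S, R.valuation (∏ i ∈ T, u i ^ e i) = 1 := by
  classical
  induction S using Finset.induction_on with
  | empty =>
    intro ι T u _ hcard
    obtain ⟨i, hi⟩ := Finset.card_pos.mp (by simpa using hcard)
    exact ⟨fun _ ↦ 1, ⟨i, hi, one_ne_zero⟩, by simp⟩
  | insert R S hRS ih =>
    intro ι T u hu hcard
    rw [Finset.card_insert_of_notMem hRS] at hcard
    simp only [Finset.forall_mem_insert] at hE ⊢
    have hv : ∀ i ∈ T, R.valuation (u i) ≠ 0 := fun i hi ↦ (Valuation.ne_zero_iff _).mpr (hu i hi)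
    by_cases hall : ∀ i ∈ T, R.valuation (u i) = 1
    · obtain ⟨e, he, h⟩ := ih hE.2 T u hu (by omega)
      refine ⟨e, he, ?_, h⟩
      rw [map_prod]
      exact Finset.prod_eq_one fun i hi ↦ by rw [map_zpow₀, hall i hi, one_zpow]
    push Not at hall
    obtain ⟨i, hi, hi1⟩ := hall
    have := isTrivialOn_of_forall_mem hE.1
    -- Elimination with pivot `u i`: each other `u j` is replaced by a monomial in `u i` and `u j`
    -- of trivial value at `R`. The exponent of `u j` is nonzero because `u i` alone has nontrivial
    -- value, so a nontrivial relation stays nontrivial.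
    have hrel : ∀ j ∈ T, ∃ m n : ℤ, n ≠ 0 ∧
        R.valuation (u i) ^ m * R.valuation (u j) ^ n = 1 := by
      intro j hj
      obtain ⟨m, n, hmn, h⟩ := exists_zpow_relation R.valuation htr (hu i hi) (hu j hj)
      refine ⟨m, n, ?_, h⟩
      rintro rfl
      simp only [ne_eq, not_true_eq_false, or_false, zpow_zero, mul_one] at hmn h
      exact hi1 (by_contra fun _ ↦ hmn ((zpow_eq_one_iff_right₀ zero_le hi1).mp h))
    choose! m n hn hmn using hrel
    obtain ⟨e, ⟨j, hj, hej⟩, h⟩ := ih hE.2 (T.erase i) (fun j ↦ u i ^ m j * u j ^ n j)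
      (fun j hj ↦ mul_ne_zero (zpow_ne_zero _ (hu i hi))
        (zpow_ne_zero _ (hu j (Finset.mem_of_mem_erase hj))))
      (by rw [Finset.card_erase_of_mem hi]; omega)
    have hprod : ∏ j ∈ T, u j ^ (if j = i then ∑ l ∈ T.erase i, m l * e l else n j * e j) =
        ∏ j ∈ T.erase i, (u i ^ m j * u j ^ n j) ^ e j := by
      rw [← Finset.mul_prod_erase _ _ hi, if_pos rfl]
      simp only [mul_zpow, Finset.prod_mul_distrib, ← zpow_mul]
      congr 1
      · induction T.erase i using Finset.induction_on with
        | empty => simp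
        | insert a s ha ihs => rw [Finset.sum_insert ha, Finset.prod_insert ha,
            zpow_add₀ (hu i hi), ihs]
      · refine Finset.prod_congr rfl fun j hj ↦ ?_
        rw [if_neg (Finset.ne_of_mem_erase hj)]
    refine ⟨fun j ↦ if j = i then ∑ l ∈ T.erase i, m l * e l else n j * e j,
      ⟨j, Finset.mem_of_mem_erase hj, ?_⟩, ?_, ?_⟩
    · simp only [if_neg (Finset.ne_of_mem_erase hj)]
      exact mul_ne_zero (hn j (Finset.mem_of_mem_erase hj)) hej
    · rw [hprod, map_prod]
      refine Finset.prod_eq_one fun l hl ↦ ?_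
      rw [map_zpow₀, map_mul, map_zpow₀, map_zpow₀, hmn l (Finset.mem_of_mem_erase hl), one_zpow]
    · rw [hprod]
      exact h

end Valuations

/-! ### The function field over `k(F)` and its dicriticals -/

section FunctionField

variable {k : Type*} [Field k]

/-- The field `k(F)` as a subfield of the field of rational functions in two variables. -/
noncomputable abbrev pencilField (F : MvPolynomial (Fin 2) k) :
    IntermediateField k (FractionRing (MvPolynomial (Fin 2) k)) :=
  IntermediateField.adjoin k {algebraMap (MvPolynomial (Fin 2) k) _ F}

theorem algebraMap_mem_pencilField (F : MvPolynomial (Fin 2) k) :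
    algebraMap (MvPolynomial (Fin 2) k) _ F ∈ pencilField F :=
  IntermediateField.mem_adjoin_simple_self k _

theorem algebraMap_C_eq (c : k) :
    algebraMap (MvPolynomial (Fin 2) k) (FractionRing (MvPolynomial (Fin 2) k))
      (MvPolynomial.C c) = algebraMap k _ c := by
  rw [← MvPolynomial.algebraMap_eq, ← IsScalarTower.algebraMap_apply]

theorem transcendental_algebraMap [IsAlgClosed k] {F : MvPolynomial (Fin 2) k}
    (hF : F ∉ Set.range (MvPolynomial.C : k → MvPolynomial (Fin 2) k)) :
    Transcendental k (algebraMap (MvPolynomial (Fin 2) k)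
      (FractionRing (MvPolynomial (Fin 2) k)) F) := by
  intro h
  have hint := h.isIntegral
  have : Algebra.IsAlgebraic k (pencilField F) :=
    IntermediateField.isAlgebraic_adjoin_simple hint
  have hbot := IntermediateField.eq_bot_of_isAlgClosed_of_isAlgebraic (pencilField F)
  have hmem := algebraMap_mem_pencilField F
  rw [hbot, IntermediateField.mem_bot] at hmem
  obtain ⟨c, hc⟩ := hmem
  refine hF ⟨c, IsFractionRing.injective (MvPolynomial (Fin 2) k)
    (FractionRing (MvPolynomial (Fin 2) k)) ?_⟩
  rw [algebraMap_C_eq, hc]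

theorem trdeg_fractionRing_mvPolynomial :
    Algebra.trdeg k (FractionRing (MvPolynomial (Fin 2) k)) = 2 := by
  rw [← trdeg_add_eq k (MvPolynomial (Fin 2) k), MvPolynomial.trdeg_of_isDomain]
  have : Algebra.IsAlgebraic (MvPolynomial (Fin 2) k) (FractionRing (MvPolynomial (Fin 2) k)) :=
    IsLocalization.isAlgebraic _ (nonZeroDivisors _)
  rw [trdeg_eq_zero]
  simp

theorem trdeg_pencilField_le_one [IsAlgClosed k] {F : MvPolynomial (Fin 2) k}
    (hF : F ∉ Set.range (MvPolynomial.C : k → MvPolynomial (Fin 2) k)) :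
    Algebra.trdeg (pencilField F) (FractionRing (MvPolynomial (Fin 2) k)) ≤ 1 := by
  have hadd := trdeg_add_eq k (pencilField F) (A := FractionRing (MvPolynomial (Fin 2) k))
  rw [trdeg_fractionRing_mvPolynomial] at hadd
  have : Algebra.Transcendental k (pencilField F) := by
    refine ⟨⟨⟨_, algebraMap_mem_pencilField F⟩, fun h ↦ transcendental_algebraMap hF ?_⟩⟩
    exact h.algebraMap (A := FractionRing (MvPolynomial (Fin 2) k))
  have hpos : 1 ≤ Algebra.trdeg k (pencilField F) :=
    Cardinal.one_le_iff_ne_zero.mpr (trdeg_pos _ _).ne'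
  have hle : 1 + Algebra.trdeg (pencilField F) (FractionRing (MvPolynomial (Fin 2) k)) ≤ 1 + 1 := by
    rw [one_add_one_eq_two, ← hadd]
    gcongr
  exact (Cardinal.add_le_add_iff_of_lt_aleph0 Cardinal.one_lt_aleph0).mp
    (by simpa [add_comm] using hle)

theorem ringHom_mem_subfield {L : Type*} [Field L] (φ : MvPolynomial (Fin 2) k →+* L)
    (S : Subfield L) (hC : ∀ c, φ (MvPolynomial.C c) ∈ S) (hX : ∀ i, φ (MvPolynomial.X i) ∈ S)
    (a : MvPolynomial (Fin 2) k) : φ a ∈ S := by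
  induction a using MvPolynomial.induction_on with
  | C c => exact hC c
  | add p q hp hq => rw [map_add]; exact add_mem hp hq
  | mul_X p i hp => rw [map_mul]; exact mul_mem hp (hX i)

/-- By the bound on the transcendence degree, `z` is a transcendence basis; the two variables
generate `K` and are algebraic over `E(z)`. -/
theorem finiteDimensional_adjoin_of_transcendental [IsAlgClosed k] {F : MvPolynomial (Fin 2) k}
    (hF : F ∉ Set.range (MvPolynomial.C : k → MvPolynomial (Fin 2) k))
    {z : FractionRing (MvPolynomial (Fin 2) k)} (hz : Transcendental (pencilField F) z) :
    FiniteDimensional (IntermediateField.adjoin (pencilField F) {z})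
      (FractionRing (MvPolynomial (Fin 2) k)) := by
  have hind : AlgebraicIndependent (pencilField F) (fun _ : Unit ↦ z) :=
    algebraicIndependent_unique_type_iff.mpr hz
  have hbasis := hind.isTranscendenceBasis_of_lift_trdeg_le_of_finite
    (by simpa using trdeg_pencilField_le_one hF)
  have halg := hbasis.isAlgebraic_field
  rw [Set.range_const] at halg
  set L := IntermediateField.adjoin (pencilField F) {z}
  set S : Set (FractionRing (MvPolynomial (Fin 2) k)) :=
    Set.range fun i : Fin 2 ↦ algebraMap (MvPolynomial (Fin 2) k) _ (MvPolynomial.X i)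
  have htop : IntermediateField.adjoin L S = ⊤ := by
    rw [eq_top_iff]
    intro x _
    obtain ⟨a, b, -, rfl⟩ := IsFractionRing.div_surjective (A := MvPolynomial (Fin 2) k) x
    have key := ringHom_mem_subfield
      (algebraMap (MvPolynomial (Fin 2) k) (FractionRing (MvPolynomial (Fin 2) k)))
      (IntermediateField.adjoin L S).toSubfield
      (fun c ↦ by
        rw [algebraMap_C_eq]
        have : algebraMap k (FractionRing (MvPolynomial (Fin 2) k)) c =
          algebraMap L _ (algebraMap (pencilField F) L (algebraMap k (pencilField F) c)) := rfl
        rw [this]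
        exact (IntermediateField.adjoin L S).algebraMap_mem _)
      (fun i ↦ IntermediateField.subset_adjoin L S ⟨i, rfl⟩)
    exact div_mem (key a) (key b)
  have hfin : FiniteDimensional L (IntermediateField.adjoin L S) :=
    have : Finite S := Set.finite_range _
    IntermediateField.finiteDimensional_adjoin fun x _ ↦ (halg.isAlgebraic x).isIntegral
  rw [htop] at hfin
  exact IntermediateField.topEquiv.toLinearEquiv.finiteDimensional

/-- A dicritical omits one of the two variables, and each variable has finitely many poles (none if
it is algebraic over `k(F)`). -/
theorem finite_dicriticals [IsAlgClosed k] {F : MvPolynomial (Fin 2) k}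
    (hF : F ∉ Set.range (MvPolynomial.C : k → MvPolynomial (Fin 2) k)) :
    (dicriticals F).Finite := by
  have hfin : ∀ i : Fin 2,
      {R : ValuationSubring (FractionRing (MvPolynomial (Fin 2) k)) |
        (∀ a : pencilField F, algebraMap (pencilField F) _ a ∈ R) ∧
          algebraMap (MvPolynomial (Fin 2) k) _ (MvPolynomial.X i) ∉ R}.Finite := by
    intro i
    by_cases hz : IsAlgebraic (pencilField F)
        (algebraMap (MvPolynomial (Fin 2) k) (FractionRing (MvPolynomial (Fin 2) k))
          (MvPolynomial.X i))
    · exact Set.finite_empty.subset fun R hR ↦ absurd (mem_of_isAlgebraic hR.1 hz) hR.2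
    · have := finiteDimensional_adjoin_of_transcendental hF hz
      have h := finite_setOf_notMem (E := pencilField F)
        (K := FractionRing (MvPolynomial (Fin 2) k)) (trdeg_pencilField_le_one hF)
        (algebraMap (MvPolynomial (Fin 2) k) (FractionRing (MvPolynomial (Fin 2) k))
          (MvPolynomial.X i))
      exact h
  refine (Set.finite_iUnion hfin).subset ?_
  rintro R ⟨hE, -, a, ha⟩
  have hE' : ∀ a : pencilField F, algebraMap (pencilField F) _ a ∈ R := fun a ↦ hE _ a.2
  rw [Set.mem_iUnion]
  by_contra! hcon
  have hX : ∀ i, algebraMap (MvPolynomial (Fin 2) k) _ (MvPolynomial.X i) ∈ R := by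
    intro i
    by_contra h
    exact hcon i ⟨hE', h⟩
  refine ha ?_
  induction a using MvPolynomial.induction_on with
  | C c =>
    rw [algebraMap_C_eq]
    exact hE' (algebraMap k (pencilField F) c)
  | add p q hp hq =>
    rw [map_add]
    by_contra h
    exact h (R.add_mem _ _ (by_contra fun h' ↦ h' (hp h')) (by_contra fun h' ↦ h' (hq h')))
  | mul_X p i hp =>
    rw [map_mul]
    exact R.mul_mem _ _ (by_contra fun h' ↦ h' (hp h')) (hX i)

end FunctionField

/-! ### Fractions algebraic over `k(F)` -/

section AlgebraicElements

open Polynomial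

variable {k : Type*} [Field k]

theorem eq_C_of_isUnit {a : MvPolynomial (Fin 2) k} (ha : IsUnit a) :
    ∃ c : k, c ≠ 0 ∧ a = MvPolynomial.C c := by
  obtain ⟨c, hc, h⟩ := MvPolynomial.isUnit_iff_eq_C_of_isReduced.mp ha
  exact ⟨c, hc.ne_zero, h⟩

/-- By unique factorization, such a divisor is a constant times a product of fibres. -/
theorem mem_adjoin_of_dvd_prod {F : MvPolynomial (Fin 2) k} (s : Multiset k)
    (hs : ∀ l ∈ s, Irreducible (F - MvPolynomial.C l)) (d : MvPolynomial (Fin 2) k)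
    (hd : d ∣ (s.map fun l ↦ F - MvPolynomial.C l).prod) : d ∈ Algebra.adjoin k {F} := by
  have hunit : ∀ a : MvPolynomial (Fin 2) k, IsUnit a → a ∈ Algebra.adjoin k {F} := by
    intro a ha
    obtain ⟨c, -, rfl⟩ := eq_C_of_isUnit ha
    exact Subalgebra.algebraMap_mem _ c
  have hfib : ∀ l, F - MvPolynomial.C l ∈ Algebra.adjoin k {F} := fun l ↦
    sub_mem (Algebra.self_mem_adjoin_singleton k F) (Subalgebra.algebraMap_mem _ l)
  induction s using Multiset.induction_on generalizing d with
  | empty => exact hunit d (isUnit_of_dvd_one (by simpa using hd))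
  | cons l s ih =>
    rw [Multiset.map_cons, Multiset.prod_cons] at hd
    obtain ⟨d₁, d₂, h₁, h₂, rfl⟩ := exists_dvd_and_dvd_of_dvd_mul hd
    refine mul_mem ?_ (ih (fun l hl ↦ hs l (Multiset.mem_cons_of_mem hl)) d₂ h₂)
    obtain ⟨e, he⟩ := h₁
    rcases (hs l (Multiset.mem_cons_self l s)).isUnit_or_isUnit he with h | h
    · exact hunit _ h
    · obtain ⟨c, hc, rfl⟩ := eq_C_of_isUnit h
      have : d₁ = (F - MvPolynomial.C l) * MvPolynomial.C c⁻¹ := by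
        rw [he, mul_assoc, ← map_mul, mul_inv_cancel₀ hc, map_one, mul_one]
      rw [this]
      exact mul_mem (hfib l) (Subalgebra.algebraMap_mem _ c⁻¹)

open scoped IntermediateField.algebraAdjoinAdjoin in
theorem isAlgebraic_algebraAdjoin {L : Type*} [Field L] [Algebra k L] {S : Set L} {u : L}
    (hu : IsAlgebraic (IntermediateField.adjoin k S) u) : IsAlgebraic (Algebra.adjoin k S) u :=
  (IsFractionRing.isAlgebraic_iff (Algebra.adjoin k S) (IntermediateField.adjoin k S) L).mpr hu

/-- Denominators in `k(F)` are cleared, and the content can be cancelled because `F` is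
transcendental. Primitivity keeps the relation nonzero after every specialization of the coefficient
variable. -/
theorem exists_primitive_relation [IsAlgClosed k] {F : MvPolynomial (Fin 2) k}
    (hF : F ∉ Set.range (MvPolynomial.C : k → MvPolynomial (Fin 2) k))
    {u : FractionRing (MvPolynomial (Fin 2) k)} (hu : IsAlgebraic (pencilField F) u) :
    ∃ p : k[X][X], p.IsPrimitive ∧
      p.eval₂ ((algebraMap (MvPolynomial (Fin 2) k) (FractionRing (MvPolynomial (Fin 2) k))).comp
        (aeval F : k[X] →ₐ[k] _).toRingHom) u = 0 := by
  classical
  set F' : FractionRing (MvPolynomial (Fin 2) k) :=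
    algebraMap (MvPolynomial (Fin 2) k) (FractionRing (MvPolynomial (Fin 2) k)) F
  have hcomp : (algebraMap (MvPolynomial (Fin 2) k) (FractionRing (MvPolynomial (Fin 2) k))).comp
      (aeval F : k[X] →ₐ[k] _).toRingHom =
      (aeval F' : k[X] →ₐ[k] (FractionRing (MvPolynomial (Fin 2) k))).toRingHom := by
    ext x
    · simpa using algebraMap_C_eq x
    · simp [F']
  rw [hcomp]
  have hu2 : IsAlgebraic (Algebra.adjoin k {F'}) u := isAlgebraic_algebraAdjoin hu
  obtain ⟨q, hq0, hq⟩ := hu2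
  have hsurj : Function.Surjective ((aeval F' :
      k[X] →ₐ[k] FractionRing (MvPolynomial (Fin 2) k)).codRestrict (Algebra.adjoin k {F'})
      fun p ↦ by rw [Algebra.adjoin_singleton_eq_range_aeval]; exact ⟨p, rfl⟩).toRingHom := by
    rintro ⟨x, hx⟩
    have hx2 := hx
    rw [Algebra.adjoin_singleton_eq_range_aeval] at hx2
    obtain ⟨p, rfl⟩ := hx2
    exact ⟨p, rfl⟩
  obtain ⟨p, rfl⟩ := Polynomial.map_surjective _ hsurj q
  have hp0 : p ≠ 0 := by rintro rfl; simp at hq0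
  have hpu : p.eval₂
      (aeval F' : k[X] →ₐ[k] FractionRing (MvPolynomial (Fin 2) k)).toRingHom u = 0 := by
    rw [aeval_def, eval₂_map] at hq
    exact hq
  let : NormalizedGCDMonoid k[X] := UniqueFactorizationMonoid.toNormalizedGCDMonoid _
  refine ⟨p.primPart, p.isPrimitive_primPart, ?_⟩
  rw [p.eq_C_content_mul_primPart, eval₂_mul, eval₂_C, mul_eq_zero] at hpu
  refine hpu.resolve_left fun h ↦ ?_
  have := (transcendental_iff_injective.mp (transcendental_algebraMap hF))
    (h.trans (map_zero (aeval F')).symm)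
  exact hp0 (content_eq_zero_iff.mp this)

/-- The relation, homogenized in `(a, b)`, vanishes at `a` and equals `b ^ n * p(F, c)` at `c * b`.
So `a - c * b` divides the latter, and it is coprime to `b`. -/
theorem sub_dvd_aeval_of_relation {F a b : MvPolynomial (Fin 2) k} (hab : IsRelPrime a b)
    (hb : b ≠ 0) {p : k[X][X]}
    (hp : p.eval₂ ((algebraMap (MvPolynomial (Fin 2) k)
        (FractionRing (MvPolynomial (Fin 2) k))).comp (aeval F : k[X] →ₐ[k] _).toRingHom)
      (algebraMap _ _ a / algebraMap _ _ b) = 0) (c : k) :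
    a - MvPolynomial.C c * b ∣ aeval F (p.eval (C c)) := by
  set ι := algebraMap (MvPolynomial (Fin 2) k) (FractionRing (MvPolynomial (Fin 2) k))
  have hb' : ι b ≠ 0 := by
    simpa [ι] using hb
  set n := p.natDegree
  let h : MvPolynomial (Fin 2) k → MvPolynomial (Fin 2) k := fun s ↦
    ∑ i ∈ Finset.range (n + 1), aeval F (p.coeff i) * (s ^ i * b ^ (n - i))
  have h1 : h a = 0 := by
    apply IsFractionRing.injective (MvPolynomial (Fin 2) k) (FractionRing (MvPolynomial (Fin 2) k))
    rw [map_zero]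
    have : ι (h a) = ι b ^ n * p.eval₂ (ι.comp (aeval F : k[X] →ₐ[k] _).toRingHom)
        (ι a / ι b) := by
      rw [eval₂_eq_sum_range, Finset.mul_sum, map_sum]
      refine Finset.sum_congr rfl fun i hi ↦ ?_
      have hi : i ≤ n := Nat.lt_succ_iff.mp (Finset.mem_range.mp hi)
      have hpow : ι b ^ n = ι b ^ i * ι b ^ (n - i) := by rw [← pow_add]; congr 1; omega
      rw [hpow, div_pow, map_mul, map_mul, map_pow, map_pow]
      field_simp
      exact mul_comm _ _
    exact this.trans (by rw [hp, mul_zero])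
  have h2 : h (MvPolynomial.C c * b) = b ^ n * aeval F (p.eval (C c)) := by
    rw [eval_eq_sum_range, map_sum, Finset.mul_sum]
    refine Finset.sum_congr rfl fun i hi ↦ ?_
    have hi : i ≤ n := Nat.lt_succ_iff.mp (Finset.mem_range.mp hi)
    have hpow : b ^ n = b ^ i * b ^ (n - i) := by rw [← pow_add]; congr 1; omega
    rw [hpow, map_mul, map_pow, aeval_C, MvPolynomial.algebraMap_eq]
    ring
  have h3 : a - MvPolynomial.C c * b ∣ h a - h (MvPolynomial.C c * b) := by
    simp only [h, ← Finset.sum_sub_distrib, ← mul_sub, ← sub_mul]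
    exact Finset.dvd_sum fun i _ ↦ ((sub_dvd_pow_sub_pow _ _ i).mul_right _).mul_left _
  rw [h1, h2, zero_sub, dvd_neg] at h3
  have hrel : IsRelPrime (a - MvPolynomial.C c * b) b := by
    intro d hd1 hd2
    refine hab ?_ hd2
    have := dvd_add hd1 (hd2.mul_left (MvPolynomial.C c))
    rwa [sub_add_cancel] at this
  exact hrel.pow_right.dvd_of_dvd_mul_left h3

/-- For all but finitely many `c`, `p(F, c)` is a constant times a product of irreducible fibres, so
its divisor `a - c * b` lies in `k[F]`. Two such `c` recover `a` and `b`. -/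
theorem mem_adjoin_of_isAlgebraic_div [IsAlgClosed k] {F : MvPolynomial (Fin 2) k}
    (hF : F ∉ Set.range (MvPolynomial.C : k → MvPolynomial (Fin 2) k))
    (hfin : {c : k | ¬ Irreducible (F - MvPolynomial.C c)}.Finite)
    {a b : MvPolynomial (Fin 2) k} (hab : IsRelPrime a b) (hb : b ≠ 0)
    (halg : IsAlgebraic (pencilField F)
      (algebraMap (MvPolynomial (Fin 2) k) (FractionRing (MvPolynomial (Fin 2) k)) a /
        algebraMap _ _ b)) :
    a ∈ Algebra.adjoin k {F} ∧ b ∈ Algebra.adjoin k {F} := by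
  classical
  obtain ⟨p, hprim, hp⟩ := exists_primitive_relation hF halg
  have hp0 : p ≠ 0 := hprim.ne_zero
  have hbad1 : {c : k | p.eval (C c) = 0}.Finite := by
    refine Set.Finite.subset (Set.Finite.preimage (C_injective.injOn) p.roots.toFinset.finite_toSet)
      fun c hc ↦ ?_
    simpa [hp0] using hc
  -- Values of `c` for which the fibre at `l` occurs in `p(F, c)`; they are finite in number because
  -- `X - l` does not divide the primitive `p`.
  have hbad2 : ∀ l : k, {c : k | (p.eval (C c)).eval l = 0}.Finite := by
    intro l
    have hne : p.map (evalRingHom l) ≠ 0 := by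
      intro h
      have hdvd : C (X - C l) ∣ p := by
        rw [C_dvd_iff_dvd_coeff]
        intro i
        rw [dvd_iff_isRoot]
        simpa using congrArg (fun q ↦ coeff q i) h
      exact not_isUnit_X_sub_C l (hprim _ hdvd)
    refine Set.Finite.subset (p.map (evalRingHom l)).roots.toFinset.finite_toSet fun c hc ↦ ?_
    have hc' : eval c (p.map (evalRingHom l)) = eval l (eval (C c) p) := by
      have := Polynomial.hom_eval₂ p (RingHom.id _) (evalRingHom l) (C c)
      simp only [RingHom.comp_id, coe_evalRingHom, eval_C] at this
      rw [eval_map]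
      exact this.symm
    simpa [hne, hc'] using hc
  have hbad := hbad1.union (hfin.biUnion fun l _ ↦ hbad2 l)
  have hmem : ∀ c ∈ (({c : k | p.eval (C c) = 0} ∪ ⋃ l ∈ {c : k | ¬ Irreducible
      (F - MvPolynomial.C c)}, {c : k | (p.eval (C c)).eval l = 0})ᶜ : Set k),
      a - MvPolynomial.C c * b ∈ Algebra.adjoin k {F} := by
    intro c hc
    simp only [Set.mem_compl_iff, Set.mem_union, Set.mem_iUnion, Set.mem_ofPred_eq, not_or,
      not_exists] at hc
    obtain ⟨hc1, hc2⟩ := hc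
    have hdvd := sub_dvd_aeval_of_relation hab hb hp c
    set q := p.eval (C c)
    have hsplit : q = C q.leadingCoeff * (q.roots.map fun l ↦ X - C l).prod :=
      (IsAlgClosed.splits q).eq_prod_roots
    have hq : aeval F q = MvPolynomial.C q.leadingCoeff *
        (q.roots.map fun l ↦ F - MvPolynomial.C l).prod := by
      conv_lhs => rw [hsplit]
      rw [map_mul, map_multiset_prod, Multiset.map_map, aeval_C, MvPolynomial.algebraMap_eq]
      simp
    rw [hq] at hdvd
    have hun : IsUnit (MvPolynomial.C q.leadingCoeff : MvPolynomial (Fin 2) k) :=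
      (isUnit_iff_ne_zero.mpr (leadingCoeff_ne_zero.mpr hc1)).map MvPolynomial.C
    rw [hun.dvd_mul_left] at hdvd
    refine mem_adjoin_of_dvd_prod q.roots (fun l hl ↦ ?_) _ hdvd
    by_contra hirr
    exact hc2 l hirr (isRoot_of_mem_roots hl)
  obtain ⟨c, hc, c', hc', hne⟩ := hbad.infinite_compl.nontrivial
  have h1 := hmem c hc
  have h2 := hmem c' hc'
  have hbmem : b ∈ Algebra.adjoin k {F} := by
    have h3 := mul_mem (Subalgebra.algebraMap_mem (Algebra.adjoin k {F}) (c' - c)⁻¹) (sub_mem h1 h2)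
    have : algebraMap k (MvPolynomial (Fin 2) k) (c' - c)⁻¹ *
        (a - MvPolynomial.C c * b - (a - MvPolynomial.C c' * b)) = b := by
      rw [MvPolynomial.algebraMap_eq, show a - MvPolynomial.C c * b - (a - MvPolynomial.C c' * b) =
        MvPolynomial.C (c' - c) * b by rw [map_sub]; ring, ← mul_assoc, ← map_mul,
        inv_mul_cancel₀ (sub_ne_zero.mpr hne.symm), map_one, one_mul]
    rwa [this] at h3
  refine ⟨?_, hbmem⟩
  have h4 := add_mem h1 (mul_mem (Subalgebra.algebraMap_mem (Algebra.adjoin k {F}) c) hbmem)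
  rwa [MvPolynomial.algebraMap_eq, sub_add_cancel] at h4

end AlgebraicElements

/-! ### Multiplicative relations between primes of fibres -/

section PrimesInFibers

variable {k : Type*} [Field k]

theorem isRelPrime_of_prime_of_not_associated {R : Type*} [CommRing R] [IsDomain R] {p q : R}
    (hp : Prime p) (hq : Prime q) (h : ¬ Associated p q) : IsRelPrime p q := by
  intro d hdp hdq
  obtain ⟨e, he⟩ := hdp
  rcases hp.irreducible.isUnit_or_isUnit he with hd | hu
  · exact hd
  · have hpd : Associated p d := by
      rw [he]
      exact (associated_mul_unit_left d e hu)
    exact absurd (hp.associated_of_dvd hq (hpd.dvd.trans hdq)) h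

theorem exists_sub_C_dvd_of_mem_adjoin [IsAlgClosed k] {F a : MvPolynomial (Fin 2) k}
    (ha : a ∈ Algebra.adjoin k {F}) (ha0 : a ≠ 0) (hau : ¬ IsUnit a) :
    ∃ l : k, F - MvPolynomial.C l ∣ a := by
  rw [Algebra.adjoin_singleton_eq_range_aeval] at ha
  obtain ⟨p, rfl⟩ := ha
  have hdeg : p.degree ≠ 0 := by
    intro h
    rw [Polynomial.eq_C_of_degree_eq_zero h] at ha0 hau
    refine hau ?_
    have hc : p.coeff 0 ≠ 0 := by
      intro h0
      simp [h0] at ha0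
    simpa [MvPolynomial.algebraMap_eq] using
      (isUnit_iff_ne_zero.mpr hc).map (MvPolynomial.C (σ := Fin 2))
  obtain ⟨l, hl⟩ := IsAlgClosed.exists_root p hdeg
  obtain ⟨q, hq⟩ := Polynomial.dvd_iff_isRoot.mpr hl
  refine ⟨l, Polynomial.aeval F q, ?_⟩
  change Polynomial.aeval F p = _
  conv_lhs => rw [hq]
  simp [MvPolynomial.algebraMap_eq]

theorem valuation_eq_one_of_dvd_fiber {F P : MvPolynomial (Fin 2) k}
    (hF : F ∉ Set.range (MvPolynomial.C : k → MvPolynomial (Fin 2) k)) {l : k}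
    (hP : P ∣ F - MvPolynomial.C l)
    {R : ValuationSubring (FractionRing (MvPolynomial (Fin 2) k))}
    (hE : ∀ a : pencilField F, algebraMap (pencilField F) _ a ∈ R)
    (hR : ∀ a : MvPolynomial (Fin 2) k,
      algebraMap _ (FractionRing (MvPolynomial (Fin 2) k)) a ∈ R) :
    R.valuation (algebraMap _ _ P) = 1 := by
  obtain ⟨Q, hQ⟩ := hP
  have htriv := isTrivialOn_of_forall_mem hE
  have hmem : algebraMap (MvPolynomial (Fin 2) k) (FractionRing (MvPolynomial (Fin 2) k))
      (F - MvPolynomial.C l) ∈ pencilField F := by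
    rw [map_sub, algebraMap_C_eq]
    exact sub_mem (algebraMap_mem_pencilField F) ((pencilField F).algebraMap_mem l)
  have hne : (⟨_, hmem⟩ : pencilField F) ≠ 0 := by
    intro h
    have h2 := congrArg Subtype.val h
    have h3 : F - MvPolynomial.C l = 0 :=
      (IsFractionRing.injective (MvPolynomial (Fin 2) k)
        (FractionRing (MvPolynomial (Fin 2) k))) (by rw [map_zero]; exact h2)
    exact hF ⟨l, (sub_eq_zero.mp h3).symm⟩
  have h1 := Valuation.IsTrivialOn.eq_one (v := R.valuation) _ hne
  have h2 : R.valuation (algebraMap _ _ P) * R.valuation (algebraMap _ _ Q) = 1 := by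
    rw [← map_mul, ← map_mul, ← hQ]
    exact h1
  have hP1 := (R.valuation_le_one_iff _).mpr (hR P)
  have hQ1 := (R.valuation_le_one_iff _).mpr (hR Q)
  refine le_antisymm hP1 ?_
  rw [← h2]
  exact mul_le_of_le_one_right' hQ1

theorem exists_zpow_prod_isAlgebraic [IsAlgClosed k] {F : MvPolynomial (Fin 2) k}
    (hF : F ∉ Set.range (MvPolynomial.C : k → MvPolynomial (Fin 2) k))
    {ι : Type*} [Fintype ι] (P : ι → MvPolynomial (Fin 2) k) (hP : ∀ i, P i ≠ 0)
    (hfib : ∀ i, ∃ l, P i ∣ F - MvPolynomial.C l)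
    (hcard : dic F ≤ Fintype.card ι) (hpos : 0 < Fintype.card ι) :
    ∃ e : ι → ℤ, (∃ i, e i ≠ 0) ∧ IsAlgebraic (pencilField F)
      (∏ i, algebraMap _ (FractionRing (MvPolynomial (Fin 2) k)) (P i) ^ e i) := by
  classical
  set u : ι → FractionRing (MvPolynomial (Fin 2) k) := fun i ↦ algebraMap _ _ (P i)
  have hu : ∀ i, u i ≠ 0 := fun i ↦ by simpa [u] using hP i
  have hfin := finite_dicriticals hF
  have hcardD : hfin.toFinset.card = dic F := (Set.ncard_eq_toFinset_card _ hfin).symm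
  have hdE : ∀ R ∈ hfin.toFinset, ∀ a : pencilField F, algebraMap (pencilField F) _ a ∈ R :=
    fun R hR a ↦ ((hfin.mem_toFinset).mp hR).1 _ a.2
  have key : ∃ e : ι → ℤ, (∃ i, e i ≠ 0) ∧
      ∀ R ∈ hfin.toFinset, R.valuation (∏ i, u i ^ e i) ≤ 1 := by
    rcases hfin.toFinset.eq_empty_or_nonempty with hemp | ⟨R₀, hR₀⟩
    · obtain ⟨i⟩ := Fintype.card_pos_iff.mp hpos
      exact ⟨fun _ ↦ 1, ⟨i, one_ne_zero⟩, by simp [hemp]⟩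
    -- One dicritical `R₀` is set aside, so that `dic F` elements suffice; the sign of the exponents
    -- is chosen afterwards to make the value at `R₀` at most `1`.
    · obtain ⟨e, ⟨i, -, hi⟩, h⟩ := exists_prod_zpow_valuation_eq_one (E := pencilField F)
        (K := FractionRing (MvPolynomial (Fin 2) k)) (trdeg_pencilField_le_one hF)
        (hfin.toFinset.erase R₀) (fun R hR ↦ hdE R (Finset.mem_of_mem_erase hR)) Finset.univ u
        (fun i _ ↦ hu i) (by
          have := Finset.card_pos.mpr ⟨R₀, hR₀⟩
          rw [Finset.card_erase_of_mem hR₀, Finset.card_univ]; omega)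
      rcases le_total (R₀.valuation (∏ i, u i ^ e i)) 1 with hle | hle
      · refine ⟨e, ⟨i, hi⟩, fun R hR ↦ ?_⟩
        by_cases hRR : R = R₀
        · rw [hRR]; exact hle
        · exact (h R (Finset.mem_erase.mpr ⟨hRR, hR⟩)).le
      · refine ⟨fun i ↦ -e i, ⟨i, neg_ne_zero.mpr hi⟩, fun R hR ↦ ?_⟩
        simp only [zpow_neg, Finset.prod_inv_distrib, map_inv₀]
        by_cases hRR : R = R₀
        · rw [hRR]; exact inv_le_one_of_one_le₀ hle
        · rw [h R (Finset.mem_erase.mpr ⟨hRR, hR⟩), inv_one]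
  obtain ⟨e, he, h⟩ := key
  refine ⟨e, he, isAlgebraic_of_forall_mem fun R hE ↦ (R.valuation_le_one_iff _).mp ?_⟩
  by_cases hR : ∀ a : MvPolynomial (Fin 2) k,
      algebraMap _ (FractionRing (MvPolynomial (Fin 2) k)) a ∈ R
  · rw [map_prod]
    refine (Finset.prod_eq_one fun i _ ↦ ?_).le
    obtain ⟨l, hl⟩ := hfib i
    rw [map_zpow₀, valuation_eq_one_of_dvd_fiber hF hl hE hR, one_zpow]
  · push Not at hR
    refine h R ((hfin.mem_toFinset).mpr ⟨fun x hx ↦ hE ⟨x, hx⟩, ?_, hR⟩)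
    rintro rfl
    obtain ⟨a, ha⟩ := hR
    exact ha (ValuationSubring.mem_top _)

theorem not_forall_fiber_exists_omitted_prime [IsAlgClosed k] {F : MvPolynomial (Fin 2) k}
    (hF : F ∉ Set.range (MvPolynomial.C : k → MvPolynomial (Fin 2) k))
    (hirr : {c : k | ¬ Irreducible (F - MvPolynomial.C c)}.Finite)
    {ι : Type*} [Fintype ι] (P : ι → MvPolynomial (Fin 2) k) (hP : ∀ i, Prime (P i))
    (hne : ∀ i j, i ≠ j → ¬ Associated (P i) (P j))
    (hfib : ∀ i, ∃ l, P i ∣ F - MvPolynomial.C l)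
    (hcard : dic F ≤ Fintype.card ι) (hpos : 0 < Fintype.card ι)
    (homit : ∀ l, ∃ Q, Prime Q ∧ Q ∣ F - MvPolynomial.C l ∧ ∀ i, ¬ Associated Q (P i)) : False := by
  classical
  obtain ⟨e, ⟨i, hi⟩, halg⟩ :=
    exists_zpow_prod_isAlgebraic hF P (fun i ↦ (hP i).ne_zero) hfib hcard hpos
  -- The positive and negative exponents involve disjoint sets of primes, so the fraction is
  -- reduced.
  set a := ∏ i, P i ^ (e i).toNat
  set b := ∏ i, P i ^ (-e i).toNat
  have ha0 : a ≠ 0 := Finset.prod_ne_zero_iff.mpr fun i _ ↦ pow_ne_zero _ (hP i).ne_zero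
  have hb0 : b ≠ 0 := Finset.prod_ne_zero_iff.mpr fun i _ ↦ pow_ne_zero _ (hP i).ne_zero
  have hab : IsRelPrime a b := by
    refine IsRelPrime.prod_left fun i _ ↦ IsRelPrime.prod_right fun j _ ↦ ?_
    by_cases hij : i = j
    · subst hij
      rcases le_total (e i) 0 with h | h
      · rw [Int.toNat_of_nonpos h, pow_zero]; exact isRelPrime_one_left
      · rw [Int.toNat_of_nonpos (neg_nonpos.mpr h), pow_zero]; exact isRelPrime_one_right
    · exact (isRelPrime_of_prime_of_not_associated (hP i) (hP j) (hne i j hij)).pow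
  have hdiv : ∏ i, algebraMap _ (FractionRing (MvPolynomial (Fin 2) k)) (P i) ^ e i =
      algebraMap _ _ a / algebraMap _ _ b := by
    rw [map_prod, map_prod, ← Finset.prod_div_distrib]
    refine Finset.prod_congr rfl fun i _ ↦ ?_
    have : algebraMap _ (FractionRing (MvPolynomial (Fin 2) k)) (P i) ≠ 0 := by
      simpa using (hP i).ne_zero
    rw [map_pow, map_pow, ← zpow_natCast, ← zpow_natCast, ← zpow_sub₀ this]
    congr 1
    omega
  rw [hdiv] at halg
  obtain ⟨ha, hb⟩ := mem_adjoin_of_isAlgebraic_div hF hirr hab hb0 halg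
  have key : ∀ n : ι → ℕ, n i ≠ 0 → ∏ j, P j ^ n j ∈ Algebra.adjoin k {F} → False := by
    intro n hn hmem
    have hnu : ¬ IsUnit (∏ j, P j ^ n j) := fun h ↦
      (hP i).not_isUnit (isUnit_of_dvd_unit ((dvd_pow_self _ hn).trans
        (Finset.dvd_prod_of_mem (fun j ↦ P j ^ n j) (Finset.mem_univ i))) h)
    obtain ⟨l, hl⟩ := exists_sub_C_dvd_of_mem_adjoin hmem
      (Finset.prod_ne_zero_iff.mpr fun i _ ↦ pow_ne_zero _ (hP i).ne_zero) hnu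
    obtain ⟨Q, hQ, hQd, hQn⟩ := homit l
    obtain ⟨j, -, hj⟩ := hQ.exists_mem_finset_dvd (hQd.trans hl)
    exact hQn j (hQ.associated_of_dvd (hP j) (hQ.dvd_of_dvd_pow hj))
  rcases lt_or_gt_of_ne hi with h | h
  · exact key _ (by omega) hb
  · exact key _ (by omega) ha

end PrimesInFibers

/-! ### Fibres with a single prime -/

section Fibers

variable {k : Type*} [Field k]

theorem exists_associated_pow_of_forall_prime_dvd {R : Type*} [CommRing R] [IsDomain R]
    [UniqueFactorizationMonoid R] {x p : R} (hx : x ≠ 0)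
    (h : ∀ q, Prime q → q ∣ x → Associated q p) : ∃ n, Associated x (p ^ n) := by
  obtain ⟨f, hf, hfx⟩ := UniqueFactorizationMonoid.exists_prime_factors x hx
  have hall : ∀ q ∈ f, Associated q p := fun q hq ↦
    h q (hf q hq) ((Multiset.dvd_prod hq).trans hfx.dvd)
  have key : ∀ s : Multiset R, (∀ q ∈ s, Associated q p) →
      Associated s.prod (p ^ Multiset.card s) := by
    intro s
    induction s using Multiset.induction_on with
    | empty => intro _; simp
    | cons a s ih =>
      intro hs
      rw [Multiset.prod_cons, Multiset.card_cons, pow_succ']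
      exact (hs a (Multiset.mem_cons_self a s)).mul_mul
        (ih fun q hq ↦ hs q (Multiset.mem_cons_of_mem hq))
  exact ⟨_, hfx.symm.trans (key f hall)⟩

/-- Over an algebraically closed field the unit in front of `p ^ n` has an `n`-th root and is
absorbed into the base. -/
theorem prime_or_exists_eq_pow [IsAlgClosed k] {x p : MvPolynomial (Fin 2) k} (hx : x ≠ 0)
    (hxu : ¬ IsUnit x) (hp : Prime p) (h : ∀ q, Prime q → q ∣ x → Associated q p) :
    Prime x ∨ ∃ (y : MvPolynomial (Fin 2) k) (m : ℕ), 1 < m ∧ x = y ^ m := by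
  obtain ⟨n, hn⟩ := exists_associated_pow_of_forall_prime_dvd hx h
  have hn0 : n ≠ 0 := by
    rintro rfl
    rw [pow_zero, associated_one_iff_isUnit] at hn
    exact hxu hn
  rcases (show n = 1 ∨ 1 < n by omega) with rfl | hn1
  · left
    rw [pow_one] at hn
    exact hn.symm.prime hp
  · right
    obtain ⟨u, hu⟩ := hn.symm
    obtain ⟨c, -, hc⟩ := eq_C_of_isUnit u.isUnit
    obtain ⟨z, hz⟩ := IsAlgClosed.exists_pow_nat_eq c (Nat.pos_of_ne_zero hn0)
    refine ⟨p * MvPolynomial.C z, n, hn1, ?_⟩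
    rw [mul_pow, ← map_pow, hz, ← hc, hu]

/-- If one fibre is `y ^ m`, every fibre has the form `y ^ m - z ^ m` with `z` constant, hence the
factor `y - z`. On an irreducible fibre the cofactor is constant, and comparing degrees contradicts
`m > 1`. -/
theorem sub_C_ne_pow [IsAlgClosed k] {F : MvPolynomial (Fin 2) k}
    (hirr : {c : k | ¬ Irreducible (F - MvPolynomial.C c)}.Finite)
    (hF : F ∉ Set.range (MvPolynomial.C : k → MvPolynomial (Fin 2) k)) (c : k)
    (y : MvPolynomial (Fin 2) k) {m : ℕ} (hm : 1 < m) : F - MvPolynomial.C c ≠ y ^ m := by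
  intro h
  have := IsAlgClosed.instInfinite (K := k)
  obtain ⟨l, hl⟩ := hirr.infinite_compl.nonempty
  have hl : Irreducible (F - MvPolynomial.C l) := by simpa using hl
  have hm0 : m ≠ 0 := by omega
  obtain ⟨z, hz⟩ := IsAlgClosed.exists_pow_nat_eq (l - c) (Nat.pos_of_ne_zero hm0)
  have hFl : F - MvPolynomial.C l = y ^ m - MvPolynomial.C z ^ m := by
    rw [← h, ← map_pow, hz, map_sub]; ring
  have hydeg : 0 < y.totalDegree := by
    rw [Nat.pos_iff_ne_zero]
    intro h0
    rw [MvPolynomial.totalDegree_eq_zero_iff_eq_C] at h0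
    refine hF ⟨y.coeff 0 ^ m + c, ?_⟩
    rw [map_add, map_pow, ← h0, ← h, sub_add_cancel]
  have hdeg : ∀ w : k, ∀ x : MvPolynomial (Fin 2) k,
      (x - MvPolynomial.C w).totalDegree = x.totalDegree := by
    intro w x
    rw [sub_eq_add_neg, ← map_neg]
    by_cases hx : x.totalDegree = 0
    · rw [MvPolynomial.totalDegree_eq_zero_iff_eq_C] at hx
      rw [hx, ← map_add, MvPolynomial.totalDegree_C, MvPolynomial.totalDegree_C]
    · refine MvPolynomial.totalDegree_add_eq_left_of_totalDegree_lt ?_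
      rw [MvPolynomial.totalDegree_C]; omega
  obtain ⟨s, hs⟩ := sub_dvd_pow_sub_pow y (MvPolynomial.C z) m
  rw [hFl, ← map_pow] at hl
  rw [← map_pow] at hs
  have hynu : ¬ IsUnit (y - MvPolynomial.C z) := by
    intro hu
    have := (MvPolynomial.isUnit_iff_totalDegree_of_isReduced.mp hu).2
    rw [hdeg] at this
    omega
  have hsu := (hl.isUnit_or_isUnit hs).resolve_left hynu
  have h1 : (y ^ m).totalDegree = y.totalDegree := by
    have h2 := congrArg MvPolynomial.totalDegree hs
    rw [hdeg, MvPolynomial.totalDegree_mul_of_isDomain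
      (by rintro h0; exact hl.ne_zero (by rw [hs, h0, zero_mul])) hsu.ne_zero, hdeg,
      (MvPolynomial.isUnit_iff_totalDegree_of_isReduced.mp hsu).2, add_zero] at h2
    exact h2
  have hpow : ∀ n : ℕ, (y ^ n).totalDegree = n * y.totalDegree := by
    intro n
    induction n with
    | zero => simp
    | succ n ih =>
      have hy0 : y ≠ 0 := by rintro rfl; simp at hydeg
      rw [pow_succ, MvPolynomial.totalDegree_mul_of_isDomain (pow_ne_zero n hy0) hy0, ih, add_mul,
        one_mul]
  rw [hpow] at h1
  nlinarith

theorem not_isUnit_of_notMem_range {G : MvPolynomial (Fin 2) k}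
    (hG : G ∉ Set.range (MvPolynomial.C : k → MvPolynomial (Fin 2) k)) : ¬ IsUnit G := by
  intro h
  obtain ⟨c, -, rfl⟩ := eq_C_of_isUnit h
  exact hG ⟨c, rfl⟩

theorem sub_C_notMem_range {F : MvPolynomial (Fin 2) k}
    (hF : F ∉ Set.range (MvPolynomial.C : k → MvPolynomial (Fin 2) k)) (c : k) :
    F - MvPolynomial.C c ∉ Set.range (MvPolynomial.C : k → MvPolynomial (Fin 2) k) := by
  rintro ⟨b, hb⟩
  exact hF ⟨b + c, by rw [map_add, hb, sub_add_cancel]⟩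

theorem ne_zero_of_notMem_range {G : MvPolynomial (Fin 2) k}
    (hG : G ∉ Set.range (MvPolynomial.C : k → MvPolynomial (Fin 2) k)) : G ≠ 0 := by
  rintro rfl
  exact hG ⟨0, map_zero _⟩

theorem eq_of_prime_dvd_fibers {F p : MvPolynomial (Fin 2) k} (hp : Prime p) {b c : k}
    (hb : p ∣ F - MvPolynomial.C b) (hc : p ∣ F - MvPolynomial.C c) : b = c := by
  by_contra hne
  have h := dvd_sub hc hb
  rw [sub_sub_sub_cancel_left, ← map_sub] at h
  exact hp.not_isUnit (isUnit_of_dvd_unit h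
    ((isUnit_iff_ne_zero.mpr (sub_ne_zero.mpr hne)).map MvPolynomial.C))

end Fibers

/-! ### Specialization to one variable -/

section Conditions

variable {k : Type*} [Field k]

/-- A `k`-algebra homomorphism to `k[T]` maps `G` to a nonconstant polynomial which is not a power
and is relatively prime to the image of `H`. -/
def HasSeparatingSpecialization (G H : MvPolynomial (Fin 2) k) : Prop :=
  ∃ ρ : MvPolynomial (Fin 2) k →ₐ[k] Polynomial k,
    ρ G ∉ Set.range (Polynomial.C : k → Polynomial k) ∧ ¬ IsPower (ρ G) ∧ IsCoprime (ρ G) (ρ H)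

/-- Two generators of an algebra of transcendence degree two are algebraically independent, so
substitution is injective. -/
theorem exists_algEquiv_of_isCoordinateSystem {X Y : MvPolynomial (Fin 2) k}
    (h : IsCoordinateSystem X Y) : ∃ σ : MvPolynomial (Fin 2) k ≃ₐ[k] MvPolynomial (Fin 2) k,
      ∀ g, σ g = MvPolynomial.aeval ![X, Y] g := by
  set φ : MvPolynomial (Fin 2) k →ₐ[k] MvPolynomial (Fin 2) k := MvPolynomial.aeval ![X, Y]
  have hsurj : Function.Surjective φ := by
    rw [← AlgHom.range_eq_top, ← Algebra.adjoin_range_eq_range_aeval, ← h]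
    congr 1
    simp [Matrix.range_cons, Set.pair_comm]
  have htop : Algebra.adjoin k (Set.range ![X, Y]) = ⊤ := by
    rw [Algebra.adjoin_range_eq_range_aeval, AlgHom.range_eq_top]
    exact hsurj
  have halg : Algebra.IsAlgebraic (Algebra.adjoin k (Set.range ![X, Y]))
      (MvPolynomial (Fin 2) k) :=
    ⟨fun a ↦ isAlgebraic_algebraMap
      (⟨a, htop ▸ Algebra.mem_top⟩ : Algebra.adjoin k (Set.range ![X, Y]))⟩
  have hinj : Function.Injective φ :=
    (Algebra.IsAlgebraic.isTranscendenceBasis_of_lift_le_trdeg_of_finite k ![X, Y]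
      (by simp)).1
  exact ⟨AlgEquiv.ofBijective φ ⟨hinj, hsurj⟩, fun g ↦ rfl⟩

theorem hasSeparatingSpecialization_of_condition {X Y G H g h : MvPolynomial (Fin 2) k}
    (hXY : IsCoordinateSystem X Y) (hg : IsExpression X Y G g) (hh : IsExpression X Y H h)
    (hc : ConditionOne g h ∨ ConditionTwo g h) :
    HasSeparatingSpecialization G H ∧ HasSeparatingSpecialization H G := by
  obtain ⟨σ, hσ⟩ := exists_algEquiv_of_isCoordinateSystem hXY
  have hG : σ.symm G = g := by rw [← hg, ← hσ, σ.symm_apply_apply]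
  have hH : σ.symm H = h := by rw [← hh, ← hσ, σ.symm_apply_apply]
  let ρ₁ : MvPolynomial (Fin 2) k →ₐ[k] Polynomial k :=
    (MvPolynomial.aeval ![Polynomial.X, 0]).comp σ.symm.toAlgHom
  let ρ₂ : MvPolynomial (Fin 2) k →ₐ[k] Polynomial k :=
    (MvPolynomial.aeval ![0, Polynomial.X]).comp σ.symm.toAlgHom
  have h1G : ρ₁ G = restrictFst g := by rw [← hG]; rfl
  have h1H : ρ₁ H = restrictFst h := by rw [← hH]; rfl
  have h2G : ρ₂ G = restrictSnd g := by rw [← hG]; rfl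
  have h2H : ρ₂ H = restrictSnd h := by rw [← hH]; rfl
  have hunit : ∀ p : Polynomial k, (∃ c : k, c ≠ 0 ∧ p = Polynomial.C c) → IsUnit p := by
    rintro _ ⟨c, hc, rfl⟩
    exact Polynomial.isUnit_C.mpr (isUnit_iff_ne_zero.mpr hc)
  rcases hc with ⟨c1, c2, c3, c4, c5⟩ | ⟨c1, c2, c3, c4, c5, c6⟩
  · refine ⟨⟨ρ₁, ?_⟩, ⟨ρ₁, ?_⟩⟩ <;> rw [h1G, h1H]
    · exact ⟨c1, c2, c5⟩
    · exact ⟨c3, c4, c5.symm⟩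
  -- Each polynomial is restricted to the axis on which the other is a nonzero constant, so
  -- coprimality is automatic.
  · refine ⟨⟨ρ₂, ?_⟩, ⟨ρ₁, ?_⟩⟩
    · rw [h2G, h2H]
      exact ⟨c4, c5, ((hunit _ c6).isRelPrime_right).isCoprime⟩
    · rw [h1G, h1H]
      exact ⟨c2, c3, ((hunit _ c1).isRelPrime_right).isCoprime⟩

/-- A prime dividing both `G` and `H` maps to a common divisor of coprime polynomials, a unit. If
all primes of `G` divided `H`, the image of `G` would be constant. -/
theorem HasSeparatingSpecialization.exists_prime {G H : MvPolynomial (Fin 2) k}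
    (h : HasSeparatingSpecialization G H) : ∃ p, Prime p ∧ p ∣ G ∧ ¬ p ∣ H := by
  obtain ⟨ρ, hc, hpow, hcop⟩ := h
  have hG0 : G ≠ 0 := by
    rintro rfl
    exact hpow ⟨0, 2, one_lt_two, by simp⟩
  have hnu : ¬ IsUnit (ρ G) := by
    intro hu
    obtain ⟨c, -, h⟩ := Polynomial.isUnit_iff.mp hu
    exact hc ⟨c, h⟩
  by_contra! hcon
  obtain ⟨f, hf, hfG⟩ := UniqueFactorizationMonoid.exists_prime_factors G hG0
  refine hnu ?_
  have hprod : Associated (ρ f.prod) (ρ G) := hfG.map ρ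
  rw [← hprod.isUnit_iff, map_multiset_prod]
  refine Multiset.prod_induction IsUnit _ (fun a b ha hb ↦ ha.mul hb) isUnit_one fun q hq ↦ ?_
  obtain ⟨p, hp, rfl⟩ := Multiset.mem_map.mp hq
  have hpG : p ∣ G := (Multiset.dvd_prod hp).trans hfG.dvd
  exact hcop.isUnit_of_dvd' (map_dvd ρ hpG) (map_dvd ρ (hcon p (hf p hp) hpG))

theorem HasSeparatingSpecialization.ne_pow {G H : MvPolynomial (Fin 2) k}
    (h : HasSeparatingSpecialization G H) (y : MvPolynomial (Fin 2) k) {m : ℕ} (hm : 1 < m) :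
    G ≠ y ^ m := by
  obtain ⟨ρ, -, hpow, -⟩ := h
  rintro rfl
  exact hpow ⟨ρ y, m, hm, map_pow ρ y m⟩

end Conditions

/-! ### Counting primes against dicriticals -/

section ReducibleFibers

variable {k : Type*} [Field k] [IsAlgClosed k]

theorem not_exists_prime_factor_pair {F : MvPolynomial (Fin 2) k}
    (hF : F ∉ Set.range (MvPolynomial.C : k → MvPolynomial (Fin 2) k))
    (hirr : {c : k | ¬ Irreducible (F - MvPolynomial.C c)}.Finite)
    {t : Fin (dic F - 1) → k} (ht : Function.Injective t)
    {P Q : Fin (dic F - 1) → MvPolynomial (Fin 2) k} (hP : ∀ i, Prime (P i)) (hQ : ∀ i, Prime (Q i))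
    (hPt : ∀ i, P i ∣ F - MvPolynomial.C (t i)) (hQt : ∀ i, Q i ∣ F - MvPolynomial.C (t i))
    (hPQ : ∀ i, ¬ Associated (P i) (Q i)) {c : k} {R R' : MvPolynomial (Fin 2) k} (hR : Prime R)
    (hR' : Prime R') (hRc : R ∣ F - MvPolynomial.C c) (hRc' : R' ∣ F - MvPolynomial.C c)
    (hRR' : ¬ Associated R R') (hRP : ∀ i, ¬ Associated R (P i))
    (hRP' : ∀ i, ¬ Associated R' (P i)) : False := by
  -- The list consists of `R` and all `P i`. Its length `dic F - 1 + 1` is at least `dic F`, even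
  -- under truncated subtraction. The omitted prime is `R'` at `c`, `Q j` at any other `t j`, and
  -- arbitrary elsewhere.
  refine not_forall_fiber_exists_omitted_prime hF hirr (ι := Option (Fin (dic F - 1)))
    (fun o ↦ o.elim R P) ?_ ?_ ?_ ?_ (Fintype.card_pos) ?_
  · rintro (_ | i)
    exacts [hR, hP i]
  · rintro (_ | i) (_ | j) hij h
    · exact hij rfl
    · exact hRP j h
    · exact hRP i h.symm
    · exact hij (congrArg some (ht (eq_of_prime_dvd_fibers (hP i) (hPt i)
        (h.dvd.trans (hPt j)))))
  · rintro (_ | i)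
    exacts [⟨c, hRc⟩, ⟨t i, hPt i⟩]
  · rw [Fintype.card_option, Fintype.card_fin]; omega
  · intro l
    by_cases hlc : l = c
    · subst hlc
      refine ⟨R', hR', hRc', ?_⟩
      rintro (_ | i) h
      exacts [hRR' h.symm, hRP' i h]
    have hother : ∀ S, Prime S → S ∣ F - MvPolynomial.C l → ¬ Associated S R := fun S hS hSl h ↦
      hlc (eq_of_prime_dvd_fibers hS hSl (h.dvd.trans hRc))
    by_cases hlt : l ∈ Set.range t
    · obtain ⟨j, rfl⟩ := hlt
      refine ⟨Q j, hQ j, hQt j, ?_⟩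
      rintro (_ | i) h
      · exact hother _ (hQ j) (hQt j) h
      · have hij : j = i := ht (eq_of_prime_dvd_fibers (hQ j) (hQt j) (h.dvd.trans (hPt i)))
        subst hij
        exact hPQ j h.symm
    · have hl := sub_C_notMem_range hF l
      obtain ⟨S, hS, hSl⟩ := WfDvdMonoid.exists_irreducible_factor
        (not_isUnit_of_notMem_range hl) (ne_zero_of_notMem_range hl)
      refine ⟨S, hS.prime, hSl, ?_⟩
      rintro (_ | i) h
      · exact hother _ hS.prime hSl h
      · exact hlt ⟨i, (eq_of_prime_dvd_fibers hS.prime hSl (h.dvd.trans (hPt i))).symm⟩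

end ReducibleFibers

end PlanePoly

theorem mainTheorem12 {k : Type*} [Field k] [IsAlgClosed k]
    (F : MvPolynomial (Fin 2) k) (hF : PlanePoly.IsRationalPolynomial F)
    (d : ℕ) (hd : d = PlanePoly.dic F)
    (t : Fin (d - 1) → k) (ht : Function.Injective t)
    (G H : Fin (d - 1) → MvPolynomial (Fin 2) k)
    (hG : ∀ i, G i ∉ Set.range (MvPolynomial.C : k → MvPolynomial (Fin 2) k))
    (hH : ∀ i, H i ∉ Set.range (MvPolynomial.C : k → MvPolynomial (Fin 2) k))
    (hGH : ∀ i, F - MvPolynomial.C (t i) = G i * H i)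
    (hcond : ∀ i, ∃ X Y g h : MvPolynomial (Fin 2) k,
      PlanePoly.IsCoordinateSystem X Y ∧
      PlanePoly.IsExpression X Y (G i) g ∧ PlanePoly.IsExpression X Y (H i) h ∧
      (PlanePoly.ConditionOne g h ∨ PlanePoly.ConditionTwo g h)) :
    {c : k | PlanePoly.IsReducible (F - MvPolynomial.C c)} = Set.range t ∧
      ∀ i, Prime (G i) ∧ Prime (H i) := by
  open PlanePoly in
  subst hd
  obtain ⟨hF, hrat⟩ := hF
  have hirr : {c : k | ¬ Irreducible (F - MvPolynomial.C c)}.Finite :=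
    hrat.subset fun c hc h ↦ hc h.1
  have hsep : ∀ i, HasSeparatingSpecialization (G i) (H i) ∧
      HasSeparatingSpecialization (H i) (G i) := by
    intro i
    obtain ⟨X, Y, g, h, hXY, hg, hh, hc⟩ := hcond i
    exact hasSeparatingSpecialization_of_condition hXY hg hh hc
  choose P hP hPG hPH using fun i ↦ (hsep i).1.exists_prime
  choose Q hQ hQH hQG using fun i ↦ (hsep i).2.exists_prime
  have hPt : ∀ i, P i ∣ F - MvPolynomial.C (t i) := fun i ↦ by
    rw [hGH]; exact (hPG i).mul_right _
  have hQt : ∀ i, Q i ∣ F - MvPolynomial.C (t i) := fun i ↦ by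
    rw [hGH]; exact (hQH i).mul_left _
  have hPQ : ∀ i, ¬ Associated (P i) (Q i) := fun i h ↦ hPH i (h.dvd.trans (hQH i))
  have hfactor : ∀ i, ∀ q, Prime q → q ∣ F - MvPolynomial.C (t i) →
      Associated q (P i) ∨ Associated q (Q i) := by
    intro i q hq hqi
    by_contra! hcon
    -- A third prime `q` of the fibre at `t i` would form, with `Q i`, a pair outside the family
    -- `P`.
    refine not_exists_prime_factor_pair hF hirr ht hP hQ hPt hQt hPQ hq (hQ i) hqi (hQt i) hcon.2
      (fun j h ↦ ?_) (fun j h ↦ ?_)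
    · have hij := ht (eq_of_prime_dvd_fibers hq hqi (h.dvd.trans (hPt j)))
      subst hij
      exact hcon.1 h
    · have hij := ht (eq_of_prime_dvd_fibers (hQ i) (hQt i) (h.dvd.trans (hPt j)))
      subst hij
      exact hPQ i h.symm
  refine ⟨Set.Subset.antisymm ?_ ?_, fun i ↦ ⟨?_, ?_⟩⟩
  · rintro c ⟨hc0, hcu, a, b, ha, hb, hab⟩
    by_contra hct
    obtain ⟨p, hp, hpc⟩ := WfDvdMonoid.exists_irreducible_factor hcu hc0
    have hnot : ∀ q, Prime q → q ∣ F - MvPolynomial.C c → ∀ i, ¬ Associated q (P i) :=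
      fun q hq hqc i h ↦ hct ⟨i, (eq_of_prime_dvd_fibers hq hqc (h.dvd.trans (hPt i))).symm⟩
    have hall : ∀ q, Prime q → q ∣ F - MvPolynomial.C c → Associated q p := by
      intro q hq hqc
      by_contra hqp
      exact not_exists_prime_factor_pair hF hirr ht hP hQ hPt hQt hPQ hq hp.prime hqc hpc hqp
        (hnot q hq hqc) (hnot p hp.prime hpc)
    rcases prime_or_exists_eq_pow hc0 hcu hp.prime hall with h | ⟨y, m, hm, h⟩
    · exact (h.irreducible.isUnit_or_isUnit hab).elim ha hb
    · exact sub_C_ne_pow hirr hF c y hm h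
  · rintro _ ⟨i, rfl⟩
    have hi := sub_C_notMem_range hF (t i)
    exact ⟨ne_zero_of_notMem_range hi, not_isUnit_of_notMem_range hi, G i, H i,
      not_isUnit_of_notMem_range (hG i), not_isUnit_of_notMem_range (hH i), hGH i⟩
  · refine (prime_or_exists_eq_pow (ne_zero_of_notMem_range (hG i))
      (not_isUnit_of_notMem_range (hG i)) (hP i) fun q hq hqG ↦ ?_).resolve_right ?_
    · refine (hfactor i q hq ?_).resolve_right fun h ↦ hQG i (h.symm.dvd.trans hqG)
      rw [hGH]; exact hqG.mul_right _
    · rintro ⟨y, m, hm, h⟩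
      exact (hsep i).1.ne_pow y hm h
  · refine (prime_or_exists_eq_pow (ne_zero_of_notMem_range (hH i))
      (not_isUnit_of_notMem_range (hH i)) (hQ i) fun q hq hqH ↦ ?_).resolve_right ?_
    · refine (hfactor i q hq ?_).resolve_left fun h ↦ hPH i (h.symm.dvd.trans hqH)
      rw [hGH]; exact hqH.mul_left _
    · rintro ⟨y, m, hm, h⟩
      exact (hsep i).2.ne_pow y hm h
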